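/- Let $(X,d)$ be a compact metric space with at least two points and let $f:X\to X$ be continuous. Let $\mathcal M_f(X)$ be the set of $f$-invariant Borel probability measures on $X$ with the weak$^*$ topology. For $x\in X$ let $V_f(x)$ be the set of weak$^*$ accumulation points, as $n\to\infty$, of the empirical measures $\mathcal E_n(x)=\frac1n\sum_{i=0}^{n-1}\delta_{f^i(x)}$. For $K\subseteq\mathcal M_f(X)$ put $G_K=\{x\in X: V_f(x)=K\}$, and for $\nu\in\mathcal M_f(X)$ put $G_\nu=G_{\{\nu\}}$. Let $Trans$ be the set of points $x\in X$ whose $\omega$-limit set under $f$ is $X$. The system $(X,f)$ has the specification property if for every $\varepsilon>0$ there is a positive integer $K_\varepsilon$ such that for every $s\ge 2$, all points $y_1,\dots,y_s\in X$ and all integers $0=a_1\le b_1<a_2\le b_2<\dots<a_s\le b_s$ with $a_{m+1}-b_m\ge K_\varepsilon$ for $1\le m\le s-1$, there is $x\in X$ with $d(f^i(x),f^{i-a_m}(y_m))<\varepsilon$ for all $a_m\le i\le b_m$ and $1\le m\le s$. A set $M\subseteq X$ has a distal pair if there are distinct $p,q\in M$ with $\liminf_{i\to\infty}d(f^i(p),f^i(q))>0$.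 A set $S\subseteq X$ is DC1-scrambled if for any two distinct $x,y\in S$ $$\forall t>0:\ \limsup_{n\to\infty}\frac1n\bigl|\{0\le i\le n-1: d(f^i(x),f^i(y))<t\}\bigr|=1,$$ $$\exists t_0>0:\ \liminf_{n\to\infty}\frac1n\bigl|\{0\le i\le n-1: d(f^i(x),f^i(y))<t_0\}\bigr|=0.$$ **Theorem.** Suppose that $(X,f)$ has the specification property and let $K$ be a nonempty compact connected subset of $\mathcal M_f(X)$. Suppose that there are $\mu\in K$, $\theta\in[0,1]$ and $\mu_1,\mu_2\in\mathcal M_f(X)$ (possibly equal) such that $\mu=\theta\mu_1+(1-\theta)\mu_2$ and each of $G_{\mu_1}$ and $G_{\mu_2}$ has a distal pair. Then for every nonempty open set $U\subseteq X$ there is an uncountable DC1-scrambled set $S\subseteq G_K\cap U\cap Trans$. -/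

import Mathlib

open MeasureTheory Filter
open scoped ENNReal

namespace DistChaos

section Topological

variable {X : Type*} [MetricSpace X]

/-- `x` `ε`-traces `y` on the time interval `[a, b]` (inclusive). -/
def Traces (f : X → X) (ε : ℝ) (x y : X) (a b : ℕ) : Prop :=
  ∀ i : ℕ, a ≤ i → i ≤ b → dist (f^[i] x) (f^[i - a] y) < ε

/-- The specification property (no periodicity of the tracing point is required).
The points and the intervals are indexed by `0, …, s - 1`. -/
def Specification (f : X → X) : Prop :=
  ∀ ε : ℝ, 0 < ε → ∃ K : ℕ, 0 < K ∧
    ∀ s : ℕ, 2 ≤ s → ∀ (y : ℕ → X) (a b : ℕ → ℕ),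
      a 0 = 0 →
      (∀ m, m < s → a m ≤ b m) →
      (∀ m, m + 1 < s → b m < a (m + 1) ∧ b m + K ≤ a (m + 1)) →
      ∃ x : X, ∀ m, m < s → Traces f ε x (y m) (a m) (b m)

/-- The proportion of times `i ∈ [0, n - 1]` with `d(fⁱ x, fⁱ y) < t`. -/
noncomputable def closeFrequency (f : X → X) (x y : X) (t : ℝ) (n : ℕ) : ℝ :=
  (((Finset.range n).filter fun i => dist (f^[i] x) (f^[i] y) < t).card : ℝ) / (n : ℝ)

/-- DC1-scrambled pairs. The sequences take values in `[0, 1]`. -/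
def IsDC1Pair (f : X → X) (x y : X) : Prop :=
  (∀ t : ℝ, 0 < t → limsup (closeFrequency f x y t) atTop = 1) ∧
    ∃ t₀ : ℝ, 0 < t₀ ∧ liminf (closeFrequency f x y t₀) atTop = 0

/-- DC1-scrambled sets. -/
def IsDC1Scrambled (f : X → X) (S : Set X) : Prop :=
  ∀ x ∈ S, ∀ y ∈ S, x ≠ y → IsDC1Pair f x y

/-- Distal pairs (the distances are bounded when `X` is compact). -/
def IsDistalPair (f : X → X) (p q : X) : Prop :=
  0 < liminf (fun i : ℕ => dist (f^[i] p) (f^[i] q)) atTop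

/-- The set `M` has a distal pair. -/
def HasDistalPair (f : X → X) (M : Set X) : Prop :=
  ∃ p ∈ M, ∃ q ∈ M, p ≠ q ∧ IsDistalPair f p q

/-- The transitive points: those whose `ω`-limit set is the whole space. -/
def transitivePoints (f : X → X) : Set X :=
  {x | omegaLimit atTop (fun n : ℕ => f^[n]) {x} = Set.univ}

end Topological

section Measures

variable {X : Type*} [MeasurableSpace X]

/-- The `f`-invariant Borel probability measures, a subset of `ProbabilityMeasure X`, which
carries the topology of weak convergence. -/
def invariantMeasures (f : X → X) : Set (ProbabilityMeasure X) :=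
  {μ | MeasurePreserving f (μ : Measure X) (μ : Measure X)}

/-- `(1 / n) ∑_{i < n} δ_{fⁱ x}`, as a measure. -/
noncomputable def empirical (f : X → X) (x : X) (n : ℕ) : Measure X :=
  (n : ℝ≥0∞)⁻¹ • ∑ i ∈ Finset.range n, Measure.dirac (f^[i] x)

theorem isProbabilityMeasure_empirical (f : X → X) (x : X) (n : ℕ) :
    IsProbabilityMeasure (empirical f x (n + 1)) := by
  constructor
  simp only [empirical, Measure.smul_apply, Measure.finsetSum_apply, measure_univ,
    Finset.sum_const, Finset.card_range, smul_eq_mul, nsmul_eq_mul, mul_one]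
  exact ENNReal.inv_mul_cancel (by simp) (ENNReal.natCast_ne_top _)

/-- The sequence of empirical probability measures of `x`; its `n`-th term (`n ≥ 0`) is the
average of the Dirac measures over the first `n + 1` points of the orbit. -/
noncomputable def empiricalMeasure (f : X → X) (x : X) (n : ℕ) : ProbabilityMeasure X :=
  ⟨empirical f x (n + 1), isProbabilityMeasure_empirical f x n⟩

variable [TopologicalSpace X] [OpensMeasurableSpace X]

/-- The set of weak accumulation points of the sequence of empirical measures of `x`. -/
def empiricalLimitSet (f : X → X) (x : X) : Set (ProbabilityMeasure X) :=
  {ν | MapClusterPt ν atTop (empiricalMeasure f x)}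

/-- The saturated set of `K`: the points whose empirical measures accumulate exactly at `K`. -/
def saturatedSet (f : X → X) (K : Set (ProbabilityMeasure X)) : Set X :=
  {x | empiricalLimitSet f x = K}

/-- The generic points of `μ`. -/
def genericPoints (f : X → X) (μ : ProbabilityMeasure X) : Set X :=
  saturatedSet f {μ}

end Measures

end DistChaos

namespace DistChaos

open Topology

/-! For every binary sequence `ξ`, specification glues a point `x ξ` from orbit segments arranged in
stages (`Specification.exists_glue`). A block of stage `k` is a gap `g k` followed by a segment of
length `n k`. Tracing errors tend to zero, gaps take a vanishing share of each stage, and each stage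
outweighs all earlier ones.

The segments of stage `k` average approximately to `α k`, where `α` moves through `K` in steps
tending to zero and accumulates at every point of `K`; such an `α` exists because `K` is compact and
connected. Hence the empirical measures follow `α` and accumulate exactly at `K`
(`mem_saturatedSet_of_averages`). Starting points are found by sampling and the strong law
(`exists_equidistributed`). No ergodicity is needed: under an invariant measure the expected orbit
sum of length `n` is exactly `n` times the integral. For `μ`, a coin of bias `θ` chooses between
generic points of `μ₁` and `μ₂`.

Even stages are the same for all `ξ`, which makes any two points close most of the time up to the
end of such a stage; their first segments start at points of a dense set, which gives transitivity.
The odd stages with `α k = μ` carry labels `c k`, each label recurring forever; there `ξ (c k)`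
selects the member of each distal pair, while the coin tosses are shared. If `ξ` and `ξ'` differ at
`m`, the stages labelled `m` keep the two points apart most of the time (`isDC1Pair_of_stages`). -/

/-! ### Sampling by the law of large numbers -/

theorem exists_equidistributed {Ω : Type*} [MeasurableSpace Ω] (ν : Measure Ω)
    [IsProbabilityMeasure ν] {ι : Type*} [Countable ι] (h : ι → Ω → ℝ)
    (hm : ∀ i, Measurable (h i)) (hi : ∀ i, Integrable (h i) ν) (d : Ω) :
    ∃ w : ℕ → Ω, w 0 = d ∧ ∀ i,
      Tendsto (fun n : ℕ => (∑ j ∈ Finset.range n, h i (w j)) / n) atTop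
        (𝓝 (∫ ω, h i ω ∂ν)) := by
  have hmp : ∀ j : ℕ, MeasurePreserving (fun w : ℕ → Ω => w j)
      (Measure.infinitePi fun _ : ℕ => ν) ν := fun j =>
    measurePreserving_eval_infinitePi (fun _ : ℕ => ν) j
  have key : ∀ i, ∀ᵐ w ∂(Measure.infinitePi fun _ : ℕ => ν),
      Tendsto (fun n : ℕ => (∑ j ∈ Finset.range n, h i (w j)) / n) atTop
        (𝓝 (∫ ω, h i ω ∂ν)) := by
    intro i
    have hint : ∫ w, h i (w 0) ∂(Measure.infinitePi fun _ : ℕ => ν) = ∫ ω, h i ω ∂ν := by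
      conv_rhs => rw [← (hmp 0).map_eq]
      rw [integral_map (hmp 0).aemeasurable (hm i).aestronglyMeasurable]
    rw [← hint]
    refine ProbabilityTheory.strong_law_ae_real (fun j (w : ℕ → Ω) => h i (w j)) ?_ ?_ ?_
    · exact (hmp 0).integrable_comp_of_integrable (hi i)
    · intro a b hab
      exact (ProbabilityTheory.iIndepFun_infinitePi (P := fun _ : ℕ => ν)
        (X := fun _ => h i) (fun _ => hm i)).indepFun hab
    · intro j
      refine ⟨((hm i).comp (hmp j).measurable).aemeasurable,
        ((hm i).comp (hmp 0).measurable).aemeasurable, ?_⟩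
      have aux : ∀ j : ℕ, Measure.map (fun w : ℕ → Ω => h i (w j))
          (Measure.infinitePi fun _ : ℕ => ν) = Measure.map (h i) ν := by
        intro j
        conv_rhs => rw [← (hmp j).map_eq]
        rw [Measure.map_map (hm i) (hmp j).measurable]
        rfl
      rw [aux j, aux 0]
  obtain ⟨w, hw⟩ := (ae_all_iff.2 key).exists
  -- Resetting one term changes each average by a constant over `n`.
  refine ⟨Function.update w 0 d, by simp, fun i => ?_⟩
  have hsum : ∀ n : ℕ, ∑ j ∈ Finset.range (n + 1), h i (Function.update w 0 d j) =
      ∑ j ∈ Finset.range (n + 1), h i (w j) + (h i d - h i (w 0)) := by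
    intro n
    rw [Finset.sum_range_succ', Finset.sum_range_succ' (fun j => h i (w j))]
    simp
  have hlim := (hw i).add (tendsto_const_div_atTop_nhds_zero_nat (h i d - h i (w 0)))
  rw [add_zero] at hlim
  refine hlim.congr' ?_
  filter_upwards [eventually_gt_atTop 0] with n hn
  obtain ⟨n, rfl⟩ := Nat.exists_eq_succ_of_ne_zero hn.ne'
  rw [Nat.succ_eq_add_one, hsum, add_div]

/-! ### Chains in connected compact spaces -/

section Chains

variable {Y : Type*} [MetricSpace Y]

/-- There is an `ε`-chain from `a` to `b`. -/
def EpsChain (ε : ℝ) (a b : Y) : Prop :=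
  ∃ (L : ℕ) (c : ℕ → Y), c 0 = a ∧ c L = b ∧ ∀ i < L, dist (c i) (c (i + 1)) < ε

theorem exists_concat_chain {ε : ℝ} (hε : 0 < ε) {a b c : Y} (hab : EpsChain ε a b)
    (hbc : EpsChain ε b c) :
    ∃ (L : ℕ) (z : ℕ → Y), z 0 = a ∧ z L = c ∧ (∃ j < L, z j = b) ∧
      ∀ i < L, dist (z i) (z (i + 1)) < ε := by
  obtain ⟨L₁, u, hu0, huL, hu⟩ := hab
  obtain ⟨L₂, v, hv0, hvL, hv⟩ := hbc
  -- The junction `b` occurs twice in succession, so it is reached strictly before the end even when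
  -- a chain is trivial.
  refine ⟨L₁ + L₂ + 1, fun i => if i ≤ L₁ then u i else v (i - L₁ - 1), by simp [hu0], ?_,
    ⟨L₁, by omega, by simp [huL]⟩, ?_⟩
  · have h1 : ¬ (L₁ + L₂ + 1 ≤ L₁) := by omega
    have h2 : L₁ + L₂ + 1 - L₁ - 1 = L₂ := by omega
    simp only [h1, if_false, h2, hvL]
  · intro i hi
    rcases lt_trichotomy i L₁ with h | h | h
    · have h1 : i ≤ L₁ := h.le
      have h2 : i + 1 ≤ L₁ := h
      simp only [h1, h2, if_true]
      exact hu i h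
    · subst h
      simpa [huL, hv0] using hε
    · have h1 : ¬ i ≤ L₁ := by omega
      have h2 : ¬ i + 1 ≤ L₁ := by omega
      have h3 : i + 1 - L₁ - 1 = (i - L₁ - 1) + 1 := by omega
      simp only [h1, h2, if_false, h3]
      exact hv _ (by omega)

theorem EpsChain.trans {ε : ℝ} (hε : 0 < ε) {a b c : Y} (hab : EpsChain ε a b)
    (hbc : EpsChain ε b c) : EpsChain ε a c := by
  obtain ⟨L, z, h0, hL, -, h⟩ := exists_concat_chain hε hab hbc
  exact ⟨L, z, h0, hL, h⟩

theorem EpsChain.of_dist_lt {ε : ℝ} {a b : Y} (h : dist a b < ε) : EpsChain ε a b := by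
  refine ⟨1, fun i => if i = 0 then a else b, by simp, by simp, fun i hi => ?_⟩
  obtain rfl : i = 0 := by omega
  simpa using h

/-- One more jump of size below `ε` shows that the reachable set and its complement are both open.
-/
theorem epsChain_of_preconnected [PreconnectedSpace Y] {ε : ℝ} (hε : 0 < ε) (a b : Y) :
    EpsChain ε a b := by
  have hclopen : IsClopen {b | EpsChain ε a b} := by
    constructor
    · rw [← isOpen_compl_iff, Metric.isOpen_iff]
      intro x hx
      refine ⟨ε, hε, fun y hy hay => hx ?_⟩
      exact EpsChain.trans hε hay (EpsChain.of_dist_lt hy)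
    · rw [Metric.isOpen_iff]
      intro x hx
      refine ⟨ε, hε, fun y hy => ?_⟩
      exact EpsChain.trans hε hx (EpsChain.of_dist_lt (by rw [dist_comm]; exact hy))
  have huniv := hclopen.eq_univ ⟨a, EpsChain.of_dist_lt (by simpa using hε)⟩
  have hb : b ∈ {b | EpsChain ε a b} := huniv ▸ Set.mem_univ b
  exact hb

/-- The successor map on pairs (loop number, position in the loop). -/
def loopStep (L : ℕ → ℕ) (s : ℕ × ℕ) : ℕ × ℕ :=
  if s.2 + 1 < L s.1 then (s.1, s.2 + 1) else (s.1 + 1, 0)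

/-- Run successively through loops based at `y₀`, the `r`-th with jumps below `1 / (r + 1)` and
passing through `d r`. -/
theorem exists_slow_dense_sequence [CompactSpace Y] [PreconnectedSpace Y] (y₀ : Y) :
    ∃ α : ℕ → Y, Tendsto (fun k => dist (α k) (α (k + 1))) atTop (𝓝 0) ∧
      (∀ y, MapClusterPt y atTop α) ∧ ∃ᶠ k in atTop, α k = y₀ := by
  have : Nonempty Y := ⟨y₀⟩
  -- Unpairing makes each term of the dense sequence the target of infinitely many loops.
  let d : ℕ → Y := fun r => TopologicalSpace.denseSeq Y (Nat.unpair r).1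
  have hloop : ∀ r : ℕ, ∃ (L : ℕ) (z : ℕ → Y), z 0 = y₀ ∧ z L = y₀ ∧ (∃ j < L, z j = d r) ∧
      ∀ i < L, dist (z i) (z (i + 1)) < 1 / ((r : ℝ) + 1) := fun r =>
    exists_concat_chain (by positivity) (epsChain_of_preconnected (by positivity) _ _)
      (epsChain_of_preconnected (by positivity) _ _)
  choose L c hc0 hcL hcd hc using hloop
  have hLpos : ∀ r, 0 < L r := fun r => by
    obtain ⟨j, hj, -⟩ := hcd r
    omega
  let st : ℕ → ℕ × ℕ := fun k => (loopStep L)^[k] (0, 0)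
  have hst : ∀ k, st (k + 1) = loopStep L (st k) := fun k =>
    Function.iterate_succ_apply' _ _ _
  have hinv : ∀ k, (st k).2 < L (st k).1 := by
    intro k
    induction k with
    | zero => exact hLpos 0
    | succ k ih =>
      rw [hst, loopStep]
      split_ifs with h
      · exact h
      · exact hLpos _
  have hreach : ∀ r, ∃ k, st k = (r, 0) ∧ r ≤ k := by
    intro r
    induction r with
    | zero => exact ⟨0, rfl, le_rfl⟩
    | succ r ih =>
      obtain ⟨k, hk, hrk⟩ := ih
      have hrun : ∀ j, j < L r → st (k + j) = (r, j) := by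
        intro j
        induction j with
        | zero => intro _; exact hk
        | succ j ihj =>
          intro hj
          rw [← add_assoc, hst, ihj (by omega), loopStep, if_pos hj]
      have hL := hLpos r
      refine ⟨k + (L r - 1) + 1, ?_, by omega⟩
      rw [hst, hrun _ (by omega), loopStep, if_neg (by simp only; omega)]
  have hvisit : ∀ r, ∀ j < L r, ∃ k ≥ r, st k = (r, j) := by
    intro r j hj
    obtain ⟨k, hk, hrk⟩ := hreach r
    refine ⟨k + j, by omega, ?_⟩
    induction j with
    | zero => exact hk
    | succ j ihj => rw [← add_assoc, hst, ihj (by omega), loopStep, if_pos hj]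
  have hmono : Monotone fun k => (st k).1 := by
    refine monotone_nat_of_le_succ fun k => ?_
    simp only [hst, loopStep]
    split_ifs <;> simp
  have htop : Tendsto (fun k => (st k).1) atTop atTop :=
    tendsto_atTop_atTop_of_monotone hmono fun r => by
      obtain ⟨k, hk, -⟩ := hreach r
      exact ⟨k, by simp [hk]⟩
  refine ⟨fun k => c (st k).1 (st k).2, ?_, ?_, ?_⟩
  · have hle : ∀ k, dist (c (st k).1 (st k).2) (c (st (k + 1)).1 (st (k + 1)).2) ≤
        1 / (((st k).1 : ℝ) + 1) := by
      intro k
      have hlt := hc _ _ (hinv k)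
      rw [hst, loopStep]
      split_ifs with h
      · exact hlt.le
      · have he : (st k).2 + 1 = L (st k).1 := by
          have := hinv k
          omega
        rw [he, hcL] at hlt
        simp only [hc0]
        exact hlt.le
    exact squeeze_zero (fun _ => dist_nonneg) hle
      (tendsto_one_div_add_atTop_nhds_zero_nat.comp htop)
  · intro y
    rw [mapClusterPt_iff_frequently]
    intro s hs
    rw [frequently_atTop]
    intro N
    obtain ⟨_, ⟨m, rfl⟩, hx⟩ := (TopologicalSpace.denseRange_denseSeq Y).inter_nhds_nonempty hs
    obtain ⟨j, hj, hjd⟩ := hcd (Nat.pair m N)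
    obtain ⟨k, hk, hkst⟩ := hvisit _ j hj
    refine ⟨k, (Nat.right_le_pair m N).trans hk, ?_⟩
    simp only [hkst, hjd, d, Nat.unpair_pair]
    exact hx
  · rw [frequently_atTop]
    intro N
    obtain ⟨k, hk, hkst⟩ := hvisit N 0 (hLpos N)
    exact ⟨k, hk, by simp [hkst, hc0]⟩

end Chains

/-- The starting time of the `k`-th stage, when the `m`-th stage consists of `s m` blocks of
length `ℓ m`. -/
def stageStart (ℓ s : ℕ → ℕ) (k : ℕ) : ℕ := ∑ m ∈ Finset.range k, s m * ℓ m

theorem stageStart_succ (ℓ s : ℕ → ℕ) (k : ℕ) :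
    stageStart ℓ s (k + 1) = stageStart ℓ s k + s k * ℓ k :=
  Finset.sum_range_succ _ _

theorem stageStart_mono (ℓ s : ℕ → ℕ) : Monotone (stageStart ℓ s) :=
  monotone_nat_of_le_succ fun k => by rw [stageStart_succ]; omega

theorem block_end_le {ℓ j s : ℕ} (h : j < s) : j * ℓ + ℓ ≤ s * ℓ := by
  calc j * ℓ + ℓ = (j + 1) * ℓ := by ring
    _ ≤ s * ℓ := Nat.mul_le_mul_right _ h

/-! ### Gluing orbit segments by specification -/

section Glue

variable {X : Type*} [MetricSpace X]

/-- Taking the orbit of `z` on `[0, T]` as the first segment appends a stage to everything built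
before, so precision and gap may change from stage to stage. -/
theorem glue_stage {f : X → X} {ε : ℝ} {K : ℕ} (hK : 0 < K)
    (hspec : ∀ s : ℕ, 2 ≤ s → ∀ (y : ℕ → X) (a b : ℕ → ℕ), a 0 = 0 → (∀ m, m < s → a m ≤ b m) →
      (∀ m, m + 1 < s → b m < a (m + 1) ∧ b m + K ≤ a (m + 1)) →
      ∃ x : X, ∀ m, m < s → Traces f ε x (y m) (a m) (b m))
    (T n s : ℕ) (hs : 0 < s) (z : X) (y : ℕ → X) :
    ∃ x, (∀ i ≤ T, dist (f^[i] x) (f^[i] z) < ε) ∧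
      ∀ j < s, ∀ i ≤ n, dist (f^[T + j * (n + K) + K + i] x) (f^[i] (y j)) < ε := by
  obtain ⟨x, hx⟩ := hspec (s + 1) (by omega)
    (fun m => Nat.casesOn m z y)
    (fun m => Nat.casesOn m 0 fun j => T + j * (n + K) + K)
    (fun m => Nat.casesOn m T fun j => T + j * (n + K) + K + n) rfl
    (by
      intro m _
      cases m with
      | zero => exact Nat.zero_le _
      | succ j => exact Nat.le_add_right _ _)
    (by
      intro m _
      cases m with
      | zero =>
        change T < T + 0 * (n + K) + K ∧ T + K ≤ T + 0 * (n + K) + K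
        omega
      | succ j =>
        have h : (j + 1) * (n + K) = j * (n + K) + (n + K) := by ring
        simp only [h]
        omega)
  refine ⟨x, fun i hi => ?_, fun j hj i hi => ?_⟩
  · simpa using hx 0 (by omega) i (Nat.zero_le _) hi
  · have h := hx (j + 1) (by omega) (T + j * (n + K) + K + i) (Nat.le_add_right _ _)
      (by simp only; omega)
    simpa only [Nat.add_sub_cancel_left] using h

/-- The corrections made at successive stages are summable, so the approximations converge. The gaps
depend on `δ` alone and precede the choice of `n` and `s`, which lets segments be chosen long
relative to the gaps. -/
theorem Specification.exists_glue [CompactSpace X] {f : X → X} (hf : Continuous f)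
    (hspec : Specification f) {δ : ℝ} (hδ : 0 < δ) :
    ∃ g : ℕ → ℕ, (∀ k, 0 < g k) ∧ ∀ n s : ℕ → ℕ, (∀ k, 0 < s k) → ∀ (u : X) (y : ℕ → ℕ → X),
      ∃ x, dist x u ≤ 2 * δ ∧ ∀ k, ∀ j < s k, ∀ i ≤ n k,
        dist (f^[stageStart (n + g) s k + j * (n k + g k) + g k + i] x) (f^[i] (y k j)) ≤
          2 * δ / 2 ^ k := by
  choose g hg hspec using fun k : ℕ => hspec (δ / 2 ^ k) (by positivity)
  refine ⟨g, hg, fun n s hs u y => ?_⟩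
  set T := stageStart (n + g) s with hT
  choose step hstep₁ hstep₂ using fun (k : ℕ) (z : X) =>
    glue_stage (hg k) (hspec k) (T k) (n k) (s k) (hs k) z (y k)
  let x : ℕ → X := fun k => Nat.rec u (fun k z => step k z) k
  have hx₁ : ∀ k, ∀ i ≤ T k, dist (f^[i] (x (k + 1))) (f^[i] (x k)) < δ / 2 ^ k :=
    fun k => hstep₁ k (x k)
  have hx₂ : ∀ k, ∀ j < s k, ∀ i ≤ n k,
      dist (f^[T k + j * (n k + g k) + g k + i] (x (k + 1))) (f^[i] (y k j)) < δ / 2 ^ k :=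
    fun k => hstep₂ k (x k)
  have hcauchy₀ : ∀ k, dist (x k) (x (k + 1)) ≤ 2 * δ / 2 / 2 ^ k := by
    intro k
    rw [dist_comm, mul_div_cancel_left₀ _ two_ne_zero]
    exact (hx₁ k 0 (Nat.zero_le _)).le
  obtain ⟨z, hz⟩ := cauchySeq_tendsto_of_complete (cauchySeq_of_le_geometric_two hcauchy₀)
  refine ⟨z, ?_, fun k j hj i hi => ?_⟩
  · rw [dist_comm]
    exact dist_le_of_le_geometric_two_of_tendsto₀ hcauchy₀ hz
  -- All corrections after stage `k` add up to at most `δ / 2 ^ k`; the error of stage `k` itself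
  -- contributes the other half of the bound.
  · have htail : ∀ i ≤ T (k + 1), dist (f^[i] (x (k + 1))) (f^[i] z) ≤ δ / 2 ^ k := by
      intro i hi
      refine dist_le_of_le_geometric_two_of_tendsto₀ (f := fun m => f^[i] (x (m + (k + 1))))
        (fun m => ?_) (a := f^[i] z) ?_ |>.trans_eq' (by simp)
      · have h := hx₁ (m + (k + 1)) i (hi.trans (stageStart_mono _ _ (by omega)))
        rw [dist_comm]
        have he : m + (k + 1) + 1 = m + 1 + (k + 1) := by omega
        simp only [he] at h
        refine h.le.trans_eq ?_
        rw [pow_add, pow_succ]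
        field_simp
      · exact (((hf.iterate i).tendsto z).comp hz).comp (tendsto_add_atTop_nat (k + 1))
    have hend : T k + j * (n k + g k) + g k + i ≤ T (k + 1) := by
      have h1 : T (k + 1) = T k + s k * (n k + g k) := stageStart_succ (n + g) s k
      have h2 : j * (n k + g k) + (n k + g k) ≤ s k * (n k + g k) := block_end_le hj
      omega
    have h1 := htail _ hend
    have h2 := hx₂ k j hj i hi
    rw [dist_comm] at h1
    calc _ ≤ _ := dist_triangle _ _ _
      _ ≤ δ / 2 ^ k + δ / 2 ^ k := add_le_add h1 h2.le
      _ = 2 * δ / 2 ^ k := by ring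

end Glue

/-! ### Upper and lower frequencies -/

section Frequencies

theorem limsup_eq_one_of_frequently {u : ℕ → ℝ} (h0 : ∀ n, 0 ≤ u n) (h1 : ∀ n, u n ≤ 1)
    (h : ∀ η > 0, ∃ᶠ n in atTop, 1 - η ≤ u n) : limsup u atTop = 1 := by
  have hbdd : IsBoundedUnder (· ≤ ·) atTop u := isBoundedUnder_of ⟨1, h1⟩
  have hcobdd : IsCoboundedUnder (· ≤ ·) atTop u :=
    (isBoundedUnder_of ⟨0, h0⟩ : IsBoundedUnder (· ≥ ·) atTop u).isCoboundedUnder_le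
  refine le_antisymm (limsup_le_of_le hcobdd (Eventually.of_forall h1)) ?_
  refine le_of_forall_pos_sub_le fun η hη => ?_
  exact le_limsup_of_frequently_le (h η hη) hbdd

theorem liminf_eq_zero_of_frequently {u : ℕ → ℝ} (h0 : ∀ n, 0 ≤ u n) (h1 : ∀ n, u n ≤ 1)
    (h : ∀ η > 0, ∃ᶠ n in atTop, u n ≤ η) : liminf u atTop = 0 := by
  have hbdd : IsBoundedUnder (· ≥ ·) atTop u := isBoundedUnder_of ⟨0, h0⟩
  have hcobdd : IsCoboundedUnder (· ≥ ·) atTop u :=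
    (isBoundedUnder_of ⟨1, h1⟩ : IsBoundedUnder (· ≤ ·) atTop u).isCoboundedUnder_ge
  refine le_antisymm ?_ (le_liminf_of_le hcobdd (Eventually.of_forall h0))
  refine le_of_forall_pos_le_add fun η hη => ?_
  rw [zero_add]
  exact liminf_le_of_frequently_le (h η hη) hbdd

variable {X : Type*} [MetricSpace X]

theorem closeFrequency_nonneg (f : X → X) (x y : X) (t : ℝ) (n : ℕ) :
    0 ≤ closeFrequency f x y t n := by
  unfold closeFrequency
  positivity

theorem closeFrequency_le_one (f : X → X) (x y : X) (t : ℝ) (n : ℕ) :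
    closeFrequency f x y t n ≤ 1 := by
  unfold closeFrequency
  refine div_le_one_of_le₀ ?_ (Nat.cast_nonneg _)
  exact_mod_cast (Finset.card_filter_le _ _).trans_eq (Finset.card_range n)

/-- This gives injectivity of the coding `ξ ↦ x ξ`, and with it uncountability. -/
theorem not_isDC1Pair_self (f : X → X) (x : X) : ¬ IsDC1Pair f x x := by
  rintro ⟨-, t, ht, h⟩
  have h1 : ∀ᶠ n in atTop, closeFrequency f x x t n = 1 := by
    filter_upwards [eventually_gt_atTop 0] with n hn
    have hn' : (n : ℝ) ≠ 0 := by positivity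
    simp [closeFrequency, ht, hn']
  rw [liminf_congr h1] at h
  simp at h

/-- In a concatenation of `s` blocks of length `g + n`, a property holding in each block at the
times after `g + i₀` fails rarely. -/
theorem card_filter_block_le (P : ℕ → Prop) [DecidablePred P] (T g n i₀ s : ℕ)
    (h : ∀ j < s, ∀ i, i₀ ≤ i → i < n → ¬ P (T + j * (n + g) + g + i)) :
    ((Finset.range (T + s * (n + g))).filter P).card ≤ T + s * (g + i₀) := by
  induction s with
  | zero => simpa using (Finset.card_filter_le (Finset.range T) P)
  | succ s ih =>
    have hsub : (Finset.range (T + (s + 1) * (n + g))).filter P ⊆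
        (Finset.range (T + s * (n + g))).filter P ∪
          Finset.Ico (T + s * (n + g)) (T + s * (n + g) + (g + i₀)) := by
      intro i hi
      simp only [Finset.mem_filter, Finset.mem_range, Finset.mem_union, Finset.mem_Ico] at hi ⊢
      by_contra hcon
      push Not at hcon
      obtain ⟨hlt, hP⟩ := hi
      have hge : T + s * (n + g) ≤ i := by
        by_contra hlt'
        exact hcon.1 (by omega) hP
      have hge' := hcon.2 hge
      rw [add_mul, one_mul] at hlt
      refine h s (by omega) (i - (T + s * (n + g) + g)) (by omega) (by omega) ?_
      convert hP using 1
      omega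
    calc _ ≤ _ := Finset.card_le_card hsub
      _ ≤ _ := Finset.card_union_le _ _
      _ ≤ (T + s * (g + i₀)) + (g + i₀) := by
        refine add_le_add (ih fun j hj => h j (by omega)) ?_
        simp
      _ = T + (s + 1) * (g + i₀) := by ring

end Frequencies

/-! ### Time averages over stages -/

section Averages

theorem abs_sum_range_le {ψ : ℕ → ℝ} {M : ℝ} (h : ∀ i, |ψ i| ≤ M) (n : ℕ) :
    |∑ i ∈ Finset.range n, ψ i| ≤ n * M := by
  refine (Finset.abs_sum_le_sum_abs _ _).trans ?_
  refine (Finset.sum_le_sum fun i _ => h i).trans_eq ?_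
  simp

/-- The time sum over `s` blocks differs little from the sum over the traced segments. -/
theorem abs_sum_blocks_sub_le {ψ : ℕ → ℝ} {ρ : ℕ → ℕ → ℝ} {M η : ℝ} (hM : ∀ i, |ψ i| ≤ M)
    (T g n s : ℕ) (h : ∀ j < s, ∀ i < n, |ψ (T + j * (n + g) + g + i) - ρ j i| ≤ η) :
    |∑ i ∈ Finset.range (s * (n + g)), ψ (T + i) -
      ∑ j ∈ Finset.range s, ∑ i ∈ Finset.range n, ρ j i| ≤ s * (g * M + n * η) := by
  induction s with
  | zero => simp
  | succ s ih =>
    have hsplit : ∑ i ∈ Finset.range ((s + 1) * (n + g)), ψ (T + i) =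
        ∑ i ∈ Finset.range (s * (n + g)), ψ (T + i) +
          (∑ i ∈ Finset.range g, ψ (T + s * (n + g) + i) +
            ∑ i ∈ Finset.range n, ψ (T + s * (n + g) + g + i)) := by
      rw [show (s + 1) * (n + g) = s * (n + g) + (g + n) by ring, Finset.sum_range_add,
        Finset.sum_range_add]
      simp only [add_assoc]
    rw [hsplit, Finset.sum_range_succ]
    have h1 := ih fun j hj => h j (by omega)
    have h2 := abs_sum_range_le (ψ := fun i => ψ (T + s * (n + g) + i)) (fun i => hM _) g
    have h3 : |∑ i ∈ Finset.range n, (ψ (T + s * (n + g) + g + i) - ρ s i)| ≤ n * η := by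
      refine (Finset.abs_sum_le_sum_abs _ _).trans ?_
      refine (Finset.sum_le_sum fun i hi => h s (by omega) i (Finset.mem_range.1 hi)).trans_eq ?_
      simp
    rw [Finset.sum_sub_distrib] at h3
    push_cast
    rw [abs_le] at h1 h2 h3 ⊢
    constructor <;> linarith [h1.1, h1.2, h2.1, h2.2, h3.1, h3.2]

/-- At a time inside a stage, the past averages nearly to the previous `c`, hence to the current
one. Complete blocks are controlled once there are `J` of them; fewer blocks, or an incomplete one,
are negligible against the past by `hJT`. -/
theorem abs_average_sub_le {ψ c : ℕ → ℝ} {M : ℝ} (hψ : ∀ i k, |ψ i - c k| ≤ M)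
    (hc : Tendsto (fun k => |c k - c (k + 1)|) atTop (𝓝 0)) {ℓ s J : ℕ → ℕ} (hℓ : ∀ k, 0 < ℓ k)
    (hJ : ∀ k, 0 < J k) (hJT : ∀ k, (k + 1) * (J (k + 1) * ℓ (k + 1)) ≤ stageStart ℓ s (k + 1))
    (hT : ∀ k, (k + 1) * stageStart ℓ s k ≤ s k * ℓ k) (hJs : ∀ k, J k ≤ s k)
    (h : ∀ η > 0, ∀ᶠ k in atTop, ∀ j, J k ≤ j → j ≤ s k →
      |∑ i ∈ Finset.range (j * ℓ k), (ψ (stageStart ℓ s k + i) - c k)| ≤ η * (j * ℓ k : ℕ))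
    {η : ℝ} (hη : 0 < η) :
    ∀ᶠ k in atTop, ∀ n, stageStart ℓ s k ≤ n → n ≤ stageStart ℓ s (k + 1) →
      |∑ i ∈ Finset.range n, (ψ i - c k)| ≤ η * n := by
  set T := stageStart ℓ s with hTdef
  have hTs : ∀ k, T (k + 1) = T k + s k * ℓ k := stageStart_succ ℓ s
  have hM : 0 ≤ M := (abs_nonneg _).trans (hψ 0 0)
  have hsmall : ∀ ε > 0, ∀ᶠ k : ℕ in atTop, M ≤ ε * (k + 1 : ℕ) := by
    intro ε hε
    obtain ⟨N, hN⟩ := exists_nat_gt (M / ε)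
    filter_upwards [eventually_ge_atTop N] with k hk
    rw [div_lt_iff₀ hε] at hN
    have : (N : ℝ) ≤ (k + 1 : ℕ) := by exact_mod_cast hk.trans (Nat.le_succ k)
    nlinarith
  have hend : ∀ ε > 0, ∀ᶠ k in atTop,
      |∑ i ∈ Finset.range (T (k + 1)), (ψ i - c k)| ≤ ε * T (k + 1) := by
    intro ε hε
    filter_upwards [h (ε / 2) (by positivity), hsmall (ε / 2) (by positivity)] with k hk hMk
    have h1 := hk (s k) (hJs k) le_rfl
    have h2 := abs_sum_range_le (ψ := fun i => ψ i - c k) (fun i => hψ i k) (T k)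
    have h3 : ((k + 1 : ℕ) : ℝ) * T k ≤ (s k * ℓ k : ℕ) := by exact_mod_cast hT k
    have h4 : (T k : ℝ) * M ≤ ε / 2 * (s k * ℓ k : ℕ) := by
      calc (T k : ℝ) * M ≤ T k * (ε / 2 * (k + 1 : ℕ)) := by gcongr
        _ = ε / 2 * ((k + 1 : ℕ) * T k) := by ring
        _ ≤ _ := by gcongr
    have h5 : (T (k + 1) : ℝ) = T k + (s k * ℓ k : ℕ) := by
      rw [hTs, Nat.cast_add]
    have h6 : 0 ≤ ε * T k := by positivity
    rw [h5, hTs, Finset.sum_range_add]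
    refine (abs_add_le _ _).trans ?_
    linarith
  have hη4 : 0 < η / 4 := by positivity
  -- The shift provides a previous stage. Its end costs `2 * (η / 4)`; a short run of blocks and the
  -- incomplete block cost at most `η / 4` each, relative to the starting time.
  rw [← map_add_atTop_eq_nat 1, eventually_map]
  filter_upwards [hend (η / 4) hη4, (tendsto_add_atTop_nat 1).eventually (h (η / 4) hη4),
    hsmall (η / 4) hη4, hc.eventually (Iio_mem_nhds hη4)] with k hk₁ hk₂ hMk hck n hn₁ hn₂
  set l := ℓ (k + 1) with hl
  obtain ⟨m, rfl⟩ := Nat.exists_eq_add_of_le hn₁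
  have hm : m ≤ s (k + 1) * l := by
    rw [hTs (k + 1), ← hl] at hn₂
    omega
  have hlpos : 0 < l := hℓ _
  have hjs : m / l ≤ s (k + 1) := by
    rw [Nat.div_le_iff_le_mul_add_pred hlpos]
    have := Nat.mul_comm (s (k + 1)) l
    omega
  have hmdec : m = m / l * l + m % l := (Nat.div_add_mod' m l).symm
  set j := m / l with hj
  set r := m % l with hr
  have hrl : r < l := Nat.mod_lt _ hlpos
  have hJl : (J (k + 1) * l : ℕ) * M ≤ η / 4 * T (k + 1) := by
    have h3 : ((k + 1 : ℕ) : ℝ) * (J (k + 1) * l : ℕ) ≤ T (k + 1) := by exact_mod_cast hJT k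
    calc ((J (k + 1) * l : ℕ) : ℝ) * M ≤ (J (k + 1) * l : ℕ) * (η / 4 * (k + 1 : ℕ)) := by gcongr
      _ = η / 4 * ((k + 1 : ℕ) * (J (k + 1) * l : ℕ)) := by ring
      _ ≤ _ := by gcongr
  have hstart : |∑ i ∈ Finset.range (T (k + 1)), (ψ i - c (k + 1))| ≤ 2 * (η / 4) * T (k + 1) := by
    have he : ∑ i ∈ Finset.range (T (k + 1)), (ψ i - c (k + 1)) =
        ∑ i ∈ Finset.range (T (k + 1)), (ψ i - c k) + T (k + 1) * (c k - c (k + 1)) := by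
      simp only [Finset.sum_sub_distrib, Finset.sum_const, Finset.card_range, nsmul_eq_mul]
      ring
    have h2 : |(T (k + 1) : ℝ) * (c k - c (k + 1))| ≤ T (k + 1) * (η / 4) := by
      rw [abs_mul, Nat.abs_cast]
      have := hck.le
      gcongr
    rw [he]
    refine (abs_add_le _ _).trans ?_
    linarith
  have hblocks : |∑ i ∈ Finset.range (j * l), (ψ (T (k + 1) + i) - c (k + 1))| ≤
      η / 4 * T (k + 1) + η / 4 * (j * l : ℕ) := by
    rcases le_total (J (k + 1)) j with hJj | hJj
    · have h1 := hk₂ j hJj hjs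
      have : 0 ≤ η / 4 * T (k + 1) := by positivity
      linarith
    · have h1 := abs_sum_range_le (ψ := fun i => ψ (T (k + 1) + i) - c (k + 1))
        (fun i => hψ _ _) (j * l)
      have h2 : ((j * l : ℕ) : ℝ) ≤ (J (k + 1) * l : ℕ) := by
        exact_mod_cast Nat.mul_le_mul_right l hJj
      have h3 : ((j * l : ℕ) : ℝ) * M ≤ (J (k + 1) * l : ℕ) * M := by gcongr
      have : 0 ≤ η / 4 * (j * l : ℕ) := by positivity
      linarith
  have hrest : |∑ i ∈ Finset.range r, (ψ (T (k + 1) + (j * l + i)) - c (k + 1))| ≤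
      η / 4 * T (k + 1) := by
    have h1 := abs_sum_range_le (ψ := fun i => ψ (T (k + 1) + (j * l + i)) - c (k + 1))
        (fun i => hψ _ _) r
    have h2 : (r : ℝ) ≤ (J (k + 1) * l : ℕ) := by
      exact_mod_cast hrl.le.trans (Nat.le_mul_of_pos_left l (hJ _))
    have h3 : (r : ℝ) * M ≤ (J (k + 1) * l : ℕ) * M := by gcongr
    linarith
  have hsum : ∑ i ∈ Finset.range (T (k + 1) + m), (ψ i - c (k + 1)) =
      ∑ i ∈ Finset.range (T (k + 1)), (ψ i - c (k + 1)) +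
        (∑ i ∈ Finset.range (j * l), (ψ (T (k + 1) + i) - c (k + 1)) +
          ∑ i ∈ Finset.range r, (ψ (T (k + 1) + (j * l + i)) - c (k + 1))) := by
    conv_lhs => rw [hmdec, Finset.sum_range_add, Finset.sum_range_add]
  rw [hsum]
  refine (abs_add_le _ _).trans ((add_le_add le_rfl (abs_add_le _ _)).trans ?_)
  have hjm : ((j * l : ℕ) : ℝ) ≤ m := by
    exact_mod_cast (by omega : j * l ≤ m)
  have : η / 4 * (j * l : ℕ) ≤ η * m := by nlinarith [Nat.cast_nonneg (α := ℝ) m]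
  push_cast at *
  linarith

end Averages

/-! ### Empirical measures and saturated sets -/

section EmpiricalMeasures

variable {X : Type*} [MetricSpace X] [CompactSpace X] [MeasurableSpace X] [BorelSpace X]

theorem integrable_continuousMap (ν : Measure X) [IsFiniteMeasure ν] (φ : C(X, ℝ)) :
    Integrable φ ν :=
  φ.continuous.integrable_of_hasCompactSupport (HasCompactSupport.of_compactSpace _)

theorem integral_empiricalMeasure (f : X → X) (x : X) (n : ℕ) (φ : C(X, ℝ)) :
    ∫ z, φ z ∂(empiricalMeasure f x n : Measure X) =
      (∑ i ∈ Finset.range (n + 1), φ (f^[i] x)) / (n + 1 : ℕ) := by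
  change ∫ z, φ z ∂(empirical f x (n + 1)) = _
  rw [empirical, integral_smul_measure, integral_finsetSum_measure]
  · simp only [integral_dirac, ENNReal.toReal_inv, ENNReal.toReal_natCast, smul_eq_mul]
    rw [div_eq_inv_mul]
  · intro i _
    exact integrable_continuousMap _ φ

theorem tendsto_average_of_mem_genericPoints {f : X → X} {ν : ProbabilityMeasure X} {p : X}
    (hp : p ∈ genericPoints f ν) (φ : C(X, ℝ)) :
    Tendsto (fun n : ℕ => (∑ i ∈ Finset.range n, φ (f^[i] p)) / n) atTop
      (𝓝 (∫ z, φ z ∂(ν : Measure X))) := by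
  have hp' : empiricalLimitSet f p = {ν} := hp
  have hlim : Tendsto (empiricalMeasure f p) atTop (𝓝 ν) := by
    -- By compactness of the space of probability measures, a unique cluster point is a limit.
    refine tendsto_nhds_of_unique_mapClusterPt fun ν' hν' => ?_
    have : ν' ∈ empiricalLimitSet f p := hν'
    rwa [hp'] at this
  have h := ProbabilityMeasure.tendsto_iff_forall_integral_tendsto.1 hlim
    (BoundedContinuousFunction.mkOfCompact φ)
  rw [← tendsto_add_atTop_iff_nat 1]
  refine h.congr fun n => ?_
  simp only [BoundedContinuousFunction.mkOfCompact_apply]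
  exact integral_empiricalMeasure f p n φ

theorem abs_integral_sub_le (ν : ProbabilityMeasure X) (φ ψ : C(X, ℝ)) :
    |∫ z, φ z ∂(ν : Measure X) - ∫ z, ψ z ∂(ν : Measure X)| ≤ ‖φ - ψ‖ := by
  rw [← integral_sub (integrable_continuousMap _ φ) (integrable_continuousMap _ ψ)]
  have h := norm_integral_le_of_norm_le_const (μ := (ν : Measure X)) (f := fun z => φ z - ψ z)
    (Eventually.of_forall fun z => (φ - ψ).norm_coe_le_norm z)
  simpa using h

/-- Two families of measures with asymptotically equal integrals on a dense set of test functions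
have the same limits. -/
theorem tendsto_of_integral_sub_tendsto {ι : Type*} {F : Filter ι} {φ : ℕ → C(X, ℝ)}
    (hφ : DenseRange φ) {a b : ι → ProbabilityMeasure X} {ν : ProbabilityMeasure X}
    (hab : ∀ m, Tendsto (fun i => ∫ z, φ m z ∂(a i : Measure X) -
      ∫ z, φ m z ∂(b i : Measure X)) F (𝓝 0)) (ha : Tendsto a F (𝓝 ν)) :
    Tendsto b F (𝓝 ν) := by
  rw [ProbabilityMeasure.tendsto_iff_forall_integral_tendsto] at ha ⊢
  intro ψ
  have hdiff : Tendsto (fun i => ∫ z, ψ z ∂(a i : Measure X) -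
      ∫ z, ψ z ∂(b i : Measure X)) F (𝓝 0) := by
    rw [Metric.tendsto_nhds]
    intro ε hε
    obtain ⟨m, hm⟩ := hφ.exists_dist_lt ψ.toContinuousMap (show 0 < ε / 4 by positivity)
    rw [dist_eq_norm] at hm
    have h := Metric.tendsto_nhds.1 (hab m) (ε / 2) (by positivity)
    filter_upwards [h] with i hi
    rw [Real.dist_eq, sub_zero] at hi ⊢
    have h1 := abs_integral_sub_le (a i) ψ.toContinuousMap (φ m)
    have h2 := abs_integral_sub_le (b i) ψ.toContinuousMap (φ m)
    simp only [BoundedContinuousFunction.coe_toContinuousMap] at h1 h2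
    rw [abs_le] at h1 h2
    rw [abs_lt] at hi ⊢
    constructor <;> linarith [h1.1, h1.2, h2.1, h2.2, hi.1, hi.2]
  have h := (ha ψ).sub hdiff
  simpa using h

/-- Along an ultrafilter, the empirical measures and the `α` of the current stage have the same
limits. Closedness of `K` gives one inclusion; reading off the ends of stages gives the other. -/
theorem mem_saturatedSet_of_averages {f : X → X} {x : X} {K : Set (ProbabilityMeasure X)}
    (hK : IsClosed K) {φ : ℕ → C(X, ℝ)} (hφ : DenseRange φ) {α : ℕ → ProbabilityMeasure X}
    (hαK : ∀ k, α k ∈ K) (hα : ∀ β ∈ K, MapClusterPt β atTop α) {T : ℕ → ℕ} (hT0 : T 0 = 0)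
    (hT : StrictMono T)
    (h : ∀ m, ∀ η > 0, ∀ᶠ k in atTop, ∀ n, T k ≤ n → n ≤ T (k + 1) →
      |∑ i ∈ Finset.range n, (φ m (f^[i] x) - ∫ z, φ m z ∂(α k : Measure X))| ≤ η * n) :
    x ∈ saturatedSet f K := by
  have happrox : ∀ m, ∀ η > 0, ∀ᶠ k in atTop, ∀ n, T k ≤ n + 1 → n + 1 ≤ T (k + 1) →
      |∫ z, φ m z ∂(empiricalMeasure f x n : Measure X) - ∫ z, φ m z ∂(α k : Measure X)| ≤ η := by
    intro m η hη
    filter_upwards [h m η hη] with k hk n hn₁ hn₂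
    have h1 := hk (n + 1) hn₁ hn₂
    have hpos : (0 : ℝ) < (n + 1 : ℕ) := by positivity
    rw [integral_empiricalMeasure, div_sub' hpos.ne', abs_div, Nat.abs_cast,
      div_le_iff₀ hpos]
    simpa [Finset.sum_sub_distrib] using h1
  have hstage : ∀ n : ℕ, ∃ k, T k ≤ n ∧ n < T (k + 1) := by
    intro n
    have hex : ∃ k, n < T (k + 1) := ⟨n, Nat.lt_of_succ_le (hT.id_le (n + 1))⟩
    refine ⟨Nat.find hex, ?_, Nat.find_spec hex⟩
    rcases Nat.eq_zero_or_pos (Nat.find hex) with h0 | h0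
    · rw [h0, hT0]
      exact Nat.zero_le _
    · have := Nat.find_min hex (Nat.sub_one_lt h0.ne')
      rw [Nat.sub_add_cancel h0] at this
      omega
  choose κ hκ₁ hκ₂ using fun n => hstage (n + 1)
  have hκ : Tendsto κ atTop atTop := by
    rw [tendsto_atTop]
    intro N
    filter_upwards [eventually_ge_atTop (T (N + 1))] with n hn
    by_contra hlt
    have := hT.monotone (show κ n + 1 ≤ N + 1 by omega)
    have := hκ₂ n
    omega
  apply Set.Subset.antisymm
  · intro ν hν
    obtain ⟨G, hG, hGν⟩ := mapClusterPt_iff_ultrafilter.1 (show MapClusterPt ν atTop _ from hν)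
    have hlim : Tendsto (fun n => α (κ n)) G (𝓝 ν) := by
      refine tendsto_of_integral_sub_tendsto hφ (fun m => ?_) hGν
      refine Tendsto.mono_left ?_ hG
      rw [Metric.tendsto_nhds]
      intro ε hε
      filter_upwards [hκ.eventually (happrox m (ε / 2) (by positivity))] with n hn
      rw [Real.dist_eq, sub_zero]
      have := hn n (hκ₁ n) (hκ₂ n).le
      linarith
    exact hK.mem_of_tendsto hlim (Eventually.of_forall fun n => hαK _)
  · intro β hβ
    obtain ⟨G, hG, hGβ⟩ := mapClusterPt_iff_ultrafilter.1 (hα β hβ)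
    have hTpos : ∀ k, 0 < T (k + 1) := fun k => by
      have := hT.id_le (k + 1)
      simp only [id] at this
      omega
    have hlim : Tendsto (fun k => empiricalMeasure f x (T (k + 1) - 1)) G (𝓝 β) := by
      refine tendsto_of_integral_sub_tendsto hφ (fun m => ?_) hGβ
      refine Tendsto.mono_left ?_ hG
      rw [Metric.tendsto_nhds]
      intro ε hε
      filter_upwards [happrox m (ε / 2) (by positivity)] with k hk
      rw [Real.dist_eq, sub_zero, abs_sub_comm]
      have hle := hT.monotone (Nat.le_succ k)
      have h1 := hTpos k
      have := hk (T (k + 1) - 1) (by simp only [Nat.succ_eq_add_one] at hle; omega) (by omega)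
      linarith
    have hTtop : Tendsto (fun k => T (k + 1) - 1) atTop atTop := by
      refine tendsto_atTop_mono (fun k => ?_) tendsto_id
      have := hT.id_le (k + 1)
      simp only [id] at this ⊢
      omega
    change MapClusterPt β atTop (empiricalMeasure f x)
    refine MapClusterPt.of_comp hTtop ?_
    exact mapClusterPt_iff_ultrafilter.2 ⟨G, hG, hlim⟩

end EmpiricalMeasures

theorem measurable_orbitSum {X : Type*} [MetricSpace X] [MeasurableSpace X]
    [BorelSpace X] {f : X → X} (hf : Continuous f) (φ : C(X, ℝ)) (n : ℕ) :
    Measurable fun x => ∑ i ∈ Finset.range n, φ (f^[i] x) :=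
  (continuous_finsetSum _ fun i _ => φ.continuous.comp (hf.iterate i)).measurable

/-! ### Segments with prescribed averages -/

section Stages

variable {X : Type*} [MetricSpace X] [CompactSpace X] [MeasurableSpace X] [BorelSpace X]

/-- One sample `w` serves both values of `b`, since only finitely many averages have to settle. -/
theorem exists_block_sequence {f : X → X} (hf : Continuous f) {Ω : Type*} [MeasurableSpace Ω]
    (ν : Measure Ω) [IsProbabilityMeasure ν] {Y : Bool → Ω → X} (hY : ∀ b, Measurable (Y b))
    (φ : ℕ → C(X, ℝ)) (a : ℕ → ℝ) {k n : ℕ} {ε : ℝ}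
    (h : ∀ b, ∀ m ≤ k,
      |∫ ω, ∑ i ∈ Finset.range n, φ m (f^[i] (Y b ω)) ∂ν - n * a m| < ε) (d : Ω) :
    ∃ w : ℕ → Ω, w 0 = d ∧ ∃ J, 0 < J ∧ ∀ j, J ≤ j → ∀ b, ∀ m ≤ k,
      |∑ t ∈ Finset.range j, ∑ i ∈ Finset.range n, φ m (f^[i] (Y b (w t))) - j * (n * a m)| ≤
        j * ε := by
  have hmeas : ∀ q : Bool × ℕ, Measurable fun ω =>
      ∑ i ∈ Finset.range n, φ q.2 (f^[i] (Y q.1 ω)) := fun q =>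
    (measurable_orbitSum hf (φ q.2) n).comp (hY q.1)
  obtain ⟨w, hw0, hw⟩ := exists_equidistributed ν
    (fun (q : Bool × ℕ) ω => ∑ i ∈ Finset.range n, φ q.2 (f^[i] (Y q.1 ω))) hmeas
    (fun q => by
      refine Integrable.of_bound (hmeas q).aestronglyMeasurable (n * ‖φ q.2‖)
        (Eventually.of_forall fun ω => ?_)
      refine (norm_sum_le _ _).trans ?_
      refine (Finset.sum_le_sum fun i _ => (φ q.2).norm_coe_le_norm _).trans_eq ?_
      simp) d
  have hev : ∀ᶠ j : ℕ in atTop, ∀ q ∈ (Finset.univ : Finset Bool) ×ˢ Finset.range (k + 1),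
      |(∑ t ∈ Finset.range j, ∑ i ∈ Finset.range n, φ q.2 (f^[i] (Y q.1 (w t)))) / j -
        n * a q.2| < ε := by
    rw [Filter.eventually_all_finset]
    intro q hq
    rw [Finset.mem_product, Finset.mem_range] at hq
    exact (((hw q).sub_const _).abs).eventually (Iio_mem_nhds (h q.1 q.2 (by omega)))
  obtain ⟨J, hJ⟩ := eventually_atTop.1 hev
  refine ⟨w, hw0, J + 1, Nat.succ_pos _, fun j hj b m hm => ?_⟩
  have h1 := hJ j (by omega) (b, m)
    (Finset.mem_product.2 ⟨Finset.mem_univ _, Finset.mem_range.2 (by omega)⟩)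
  have hjpos : (0 : ℝ) < j := by exact_mod_cast (by omega : 0 < j)
  rw [div_sub' hjpos.ne', abs_div, Nat.abs_cast, div_lt_iff₀ hjpos] at h1
  rw [mul_comm _ ε]
  exact h1.le

theorem integral_orbitSum_of_invariant {f : X → X} (hf : Continuous f) {α : ProbabilityMeasure X}
    (hα : α ∈ invariantMeasures f) (φ : C(X, ℝ)) (n : ℕ) :
    ∫ x, ∑ i ∈ Finset.range n, φ (f^[i] x) ∂(α : Measure X) =
      n * ∫ x, φ x ∂(α : Measure X) := by
  have hα' : MeasurePreserving f (α : Measure X) (α : Measure X) := hα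
  rw [integral_finsetSum (f := fun i x => φ (f^[i] x)) _ fun i _ =>
    integrable_continuousMap _ (φ.comp ⟨f^[i], hf.iterate i⟩)]
  have h : ∀ i, ∫ x, φ (f^[i] x) ∂(α : Measure X) = ∫ x, φ x ∂(α : Measure X) := fun i => by
    conv_rhs => rw [← (hα'.iterate i).map_eq]
    rw [integral_map (hα'.iterate i).aemeasurable φ.continuous.aestronglyMeasurable]
  simp [h]

theorem exists_common_stage {f : X → X} (hf : Continuous f) {α : ProbabilityMeasure X}
    (hα : α ∈ invariantMeasures f) (φ : ℕ → C(X, ℝ)) (k g : ℕ) (d : X) :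
    ∃ (n J : ℕ) (y : ℕ → X), 0 < J ∧ (k + 1) * g ≤ n ∧ k + 1 ≤ n ∧ y 0 = d ∧
      ∀ j, J ≤ j → ∀ m ≤ k, |∑ t ∈ Finset.range j, ∑ i ∈ Finset.range n, φ m (f^[i] (y t)) -
        j * (n * ∫ z, φ m z ∂(α : Measure X))| ≤ j * ((n : ℝ) / (k + 1)) := by
  obtain ⟨w, hw0, J, hJ, h⟩ := exists_block_sequence hf (α : Measure X) (Y := fun _ x => x)
    (fun _ => measurable_id) φ (fun m => ∫ z, φ m z ∂(α : Measure X)) (k := k)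
    (n := (k + 1) * g + (k + 1)) (ε := (((k + 1) * g + (k + 1) : ℕ) : ℝ) / (k + 1))
    (fun b m _ => by
      rw [integral_orbitSum_of_invariant hf hα, sub_self, abs_zero]
      positivity) d
  exact ⟨_, J, w, hJ, Nat.le_add_right _ _, Nat.le_add_left _ _, hw0,
    fun j hj m hm => h j hj true m hm⟩

theorem integral_convexComb {Ω : Type*} [MeasurableSpace Ω] {ν₁ ν₂ : Measure Ω} {h : Ω → ℝ}
    (h₁ : Integrable h ν₁) (h₂ : Integrable h ν₂) {θ : ℝ} (hθ : θ ∈ Set.Icc (0 : ℝ) 1) :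
    ∫ ω, h ω ∂(ENNReal.ofReal θ • ν₁ + ENNReal.ofReal (1 - θ) • ν₂) =
      θ * ∫ ω, h ω ∂ν₁ + (1 - θ) * ∫ ω, h ω ∂ν₂ := by
  rw [integral_add_measure (h₁.smul_measure ENNReal.ofReal_ne_top)
    (h₂.smul_measure ENNReal.ofReal_ne_top), integral_smul_measure, integral_smul_measure,
    ENNReal.toReal_ofReal hθ.1, ENNReal.toReal_ofReal (sub_nonneg.2 hθ.2), smul_eq_mul,
    smul_eq_mul]

/-- Here the sample space is a coin of bias `θ`. Both values of `b` see the same tosses, so at each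
position they use the same pair. -/
theorem exists_distal_stage {f : X → X} (hf : Continuous f) {μ μ₁ μ₂ : ProbabilityMeasure X}
    {θ : ℝ} (hθ : θ ∈ Set.Icc (0 : ℝ) 1)
    (hcomb : (μ : Measure X) =
      ENNReal.ofReal θ • (μ₁ : Measure X) + ENNReal.ofReal (1 - θ) • (μ₂ : Measure X))
    {p₁ p₂ : Bool → X} (hp₁ : ∀ b, p₁ b ∈ genericPoints f μ₁)
    (hp₂ : ∀ b, p₂ b ∈ genericPoints f μ₂) (φ : ℕ → C(X, ℝ)) (k g : ℕ) :
    ∃ (n J : ℕ) (y : Bool → ℕ → X), 0 < J ∧ (k + 1) * g ≤ n ∧ k + 1 ≤ n ∧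
      (∀ t, (∀ b, y b t = p₁ b) ∨ ∀ b, y b t = p₂ b) ∧
      ∀ j, J ≤ j → ∀ b, ∀ m ≤ k,
        |∑ t ∈ Finset.range j, ∑ i ∈ Finset.range n, φ m (f^[i] (y b t)) -
          j * (n * ∫ z, φ m z ∂(μ : Measure X))| ≤ j * ((n : ℝ) / (k + 1)) := by
  let ν : Measure Bool :=
    ENNReal.ofReal θ • Measure.dirac true + ENNReal.ofReal (1 - θ) • Measure.dirac false
  have : IsProbabilityMeasure ν := ⟨by
    simp only [ν, Measure.add_apply, Measure.smul_apply, measure_univ, smul_eq_mul, mul_one]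
    rw [← ENNReal.ofReal_add hθ.1 (sub_nonneg.2 hθ.2)]
    simp⟩
  have hint : ∀ h : Bool → ℝ, ∫ e, h e ∂ν = θ * h true + (1 - θ) * h false := fun h => by
    rw [integral_convexComb (Integrable.of_finite) (Integrable.of_finite) hθ, integral_dirac,
      integral_dirac]
  have hμ : ∀ φ : C(X, ℝ), ∫ z, φ z ∂(μ : Measure X) =
      θ * ∫ z, φ z ∂(μ₁ : Measure X) + (1 - θ) * ∫ z, φ z ∂(μ₂ : Measure X) := fun φ => by
    rw [hcomb, integral_convexComb (integrable_continuousMap _ φ)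
      (integrable_continuousMap _ φ) hθ]
  let Y : Bool → Bool → X := fun b e => if e then p₁ b else p₂ b
  have hev : ∀ᶠ n : ℕ in atTop, ∀ q ∈ (Finset.univ : Finset Bool) ×ˢ Finset.range (k + 1),
      |(∫ e, ∑ i ∈ Finset.range n, φ q.2 (f^[i] (Y q.1 e)) ∂ν) / n -
        ∫ z, φ q.2 z ∂(μ : Measure X)| < 1 / (k + 1) := by
    rw [Filter.eventually_all_finset]
    rintro ⟨b, m⟩ -
    have h1 := ((tendsto_average_of_mem_genericPoints (hp₁ b) (φ m)).const_mul θ).add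
      ((tendsto_average_of_mem_genericPoints (hp₂ b) (φ m)).const_mul (1 - θ))
    rw [← hμ] at h1
    have h2 := (h1.sub_const (∫ z, φ m z ∂(μ : Measure X))).abs
    rw [sub_self, abs_zero] at h2
    filter_upwards [h2.eventually (Iio_mem_nhds (show (0 : ℝ) < 1 / (k + 1) by positivity))]
      with n hn
    rw [hint]
    refine lt_of_eq_of_lt ?_ hn
    simp only [Y, if_true, Bool.false_eq_true, if_false]
    congr 2
    ring
  obtain ⟨N, hN⟩ := eventually_atTop.1 hev
  set n := N + ((k + 1) * g + (k + 1)) with hn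
  have hnpos : (0 : ℝ) < n := by positivity
  obtain ⟨w, -, J, hJ, h⟩ := exists_block_sequence hf ν (Y := Y)
    (fun _ => measurable_of_finite _) φ (fun m => ∫ z, φ m z ∂(μ : Measure X)) (k := k)
    (n := n) (ε := (n : ℝ) / (k + 1)) (fun b m hm => by
      have h1 := hN n (by omega) (b, m)
        (Finset.mem_product.2 ⟨Finset.mem_univ _, Finset.mem_range.2 (by omega)⟩)
      rw [div_sub' hnpos.ne', abs_div, Nat.abs_cast, div_lt_iff₀ hnpos] at h1
      refine h1.trans_eq ?_
      ring) true
  refine ⟨n, J, fun b t => Y b (w t), hJ, by omega, by omega, fun t => ?_, h⟩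
  cases hwt : w t
  · exact Or.inr fun b => by simp [Y, hwt]
  · exact Or.inl fun b => by simp [Y, hwt]

end Stages

/-! ### Labels and stage lengths -/

section Sequences

theorem tendsto_half_atTop : Tendsto (fun k : ℕ => k / 2) atTop atTop :=
  tendsto_atTop_atTop.2 fun b => ⟨2 * b, fun a ha => by omega⟩

theorem tendsto_double_atTop : Tendsto (fun k : ℕ => 2 * k) atTop atTop :=
  tendsto_atTop_mono (fun k => by simp only [id]; omega) tendsto_id

/-- The label of an occurrence is the first component of its unpaired rank, so every label recurs.
-/
theorem exists_labelling {P : ℕ → Prop} (h : ∃ᶠ k in atTop, P k) :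
    ∃ c : ℕ → ℕ, ∀ m, ∃ᶠ k in atTop, P k ∧ c k = m := by
  classical
  have hinf : (Set.ofPred P).Infinite := Nat.frequently_atTop_iff_infinite.1 h
  refine ⟨fun k => (Nat.unpair (Nat.count P k)).1, fun m => frequently_atTop.2 fun N => ?_⟩
  refine ⟨Nat.nth P (Nat.pair m N), ?_, Nat.nth_mem_of_infinite hinf _, ?_⟩
  · exact (Nat.right_le_pair m N).trans ((Nat.nth_strictMono hinf).id_le _)
  · simp only [Nat.count_nth_of_infinite hinf, Nat.unpair_pair]

theorem exists_stage_sizes (ℓ J : ℕ → ℕ) (hℓ : ∀ k, 0 < ℓ k) :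
    ∃ s : ℕ → ℕ, (∀ k, J k ≤ s k) ∧ (∀ k, (k + 1) * stageStart ℓ s k ≤ s k * ℓ k) ∧
      ∀ k, (k + 1) * (J (k + 1) * ℓ (k + 1)) ≤ stageStart ℓ s (k + 1) := by
  -- One summand for each of the three demands. The recursion runs on the starting time, as `s k`
  -- depends on earlier stages only through it.
  let F : ℕ → ℕ → ℕ := fun k t => J k + (k + 1) * t + (k + 1) * (J (k + 1) * ℓ (k + 1))
  let T : ℕ → ℕ := fun k => Nat.rec 0 (fun k t => t + F k t * ℓ k) k
  let s : ℕ → ℕ := fun k => F k (T k)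
  have hT : ∀ k, stageStart ℓ s k = T k := by
    intro k
    induction k with
    | zero => rfl
    | succ k ih => rw [stageStart_succ, ih]
  have hle : ∀ k, s k ≤ s k * ℓ k := fun k => Nat.le_mul_of_pos_right _ (hℓ k)
  have hs : ∀ k, s k = J k + (k + 1) * T k + (k + 1) * (J (k + 1) * ℓ (k + 1)) := fun _ => rfl
  refine ⟨s, fun k => ?_, fun k => ?_, fun k => ?_⟩
  · rw [hs, add_assoc]
    exact Nat.le_add_right _ _
  · rw [hT]
    have h1 := hle k
    have h2 := hs k
    omega
  · rw [stageStart_succ]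
    have h1 := hle k
    have h2 := hs k
    omega

theorem strictMono_stageStart {ℓ s : ℕ → ℕ} (hℓ : ∀ k, 0 < ℓ k) (hs : ∀ k, 0 < s k) :
    StrictMono (stageStart ℓ s) :=
  strictMono_nat_of_lt_succ fun k => by
    rw [stageStart_succ]
    have := Nat.mul_pos (hs k) (hℓ k)
    omega

end Sequences

/-! ### A slow sequence of measures in `K` -/

section Measures

variable {X : Type*} [MetricSpace X] [CompactSpace X] [MeasurableSpace X] [BorelSpace X]

theorem exists_measure_sequence {K : Set (ProbabilityMeasure X)} (hK : IsCompact K)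
    (hconn : IsConnected K) {μ : ProbabilityMeasure X} (hμ : μ ∈ K) :
    ∃ α : ℕ → ProbabilityMeasure X, (∀ k, α k ∈ K) ∧
      (∀ φ : C(X, ℝ), Tendsto (fun k => |∫ z, φ z ∂(α k : Measure X) -
        ∫ z, φ z ∂(α (k + 1) : Measure X)|) atTop (𝓝 0)) ∧
      (∀ β ∈ K, MapClusterPt β atTop α) ∧ ∃ᶠ k in atTop, Odd k ∧ α k = μ := by
  let : MetricSpace K := TopologicalSpace.metrizableSpaceMetric K
  have : CompactSpace K := isCompact_iff_compactSpace.1 hK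
  have : ConnectedSpace K := isConnected_iff_connectedSpace.1 hconn
  obtain ⟨α, hα, hcl, hfr⟩ := exists_slow_dense_sequence (⟨μ, hμ⟩ : K)
  -- Each term is repeated, so every visit to `μ` also occurs at an odd index, leaving the even ones
  -- for the common stages.
  refine ⟨fun k => α (k / 2), fun k => (α (k / 2)).2, fun φ => ?_, fun β hβ => ?_, ?_⟩
  · have hcont : Continuous fun ν : K => ∫ z, φ z ∂((ν : ProbabilityMeasure X) : Measure X) :=
      (ProbabilityMeasure.continuous_integral_boundedContinuousFunction
        (f := BoundedContinuousFunction.mkOfCompact φ)).comp continuous_subtype_val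
    have huc := CompactSpace.uniformContinuous_of_continuous hcont
    rw [Metric.uniformContinuous_iff] at huc
    rw [Metric.tendsto_nhds]
    intro ε hε
    obtain ⟨δ, hδ, h⟩ := huc ε hε
    filter_upwards [tendsto_half_atTop.eventually (hα.eventually (Iio_mem_nhds hδ))] with k hk
    rw [Real.dist_eq, sub_zero, abs_abs]
    rcases (by omega : (k + 1) / 2 = k / 2 ∨ (k + 1) / 2 = k / 2 + 1) with he | he
    · rw [he, sub_self, abs_zero]
      exact hε
    · rw [he]
      exact h hk
  · have h1 : MapClusterPt β atTop fun j => (α j : ProbabilityMeasure X) :=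
      (hcl ⟨β, hβ⟩).continuousAt_comp continuous_subtype_val.continuousAt
    refine MapClusterPt.of_comp tendsto_double_atTop ?_
    convert h1 using 1
    funext j
    simp
  · rw [frequently_atTop] at hfr ⊢
    intro N
    obtain ⟨k, hk, hkμ⟩ := hfr N
    refine ⟨2 * k + 1, by omega, ⟨k, rfl⟩, ?_⟩
    have he : (2 * k + 1) / 2 = k := by omega
    simp only [he, hkμ]

end Measures

/-! ### Frequencies and averages of traced orbits -/

section Tracing

variable {X : Type*} [MetricSpace X]

theorem HasDistalPair.exists_bool_family {f : X → X} {M : Set X} (h : HasDistalPair f M) :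
    ∃ p : Bool → X, (∀ b, p b ∈ M) ∧ ∃ t > 0, ∃ N, ∀ b b', b ≠ b' → ∀ i ≥ N,
      t ≤ dist (f^[i] (p b)) (f^[i] (p b')) := by
  obtain ⟨p, hp, q, hq, -, hpq⟩ := h
  obtain ⟨t, ht, htl⟩ := exists_between 
    (show 0 < liminf (fun i : ℕ => dist (f^[i] p) (f^[i] q)) atTop from hpq)
  have hev := eventually_lt_of_lt_liminf htl (isBoundedUnder_of ⟨0, fun _ => dist_nonneg⟩)
  obtain ⟨N, hN⟩ := eventually_atTop.1 hev
  refine ⟨fun b => if b then p else q, fun b => by cases b <;> simpa, t, ht, N, ?_⟩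
  intro b b' hb i hi
  cases b <;> cases b' <;> simp at hb ⊢
  · rw [dist_comm]
    exact (hN i hi).le
  · exact (hN i hi).le

/-- Both frequencies are evaluated at the ends of stages, where the past, the gaps and the first `N`
times of each segment form a vanishing proportion. -/
theorem isDC1Pair_of_stages {f : X → X} {x x' : X} {n g s : ℕ → ℕ}
    (hT : ∀ k, (k + 1) * stageStart (n + g) s k ≤ s k * (n k + g k))
    (hg : ∀ k, (k + 1) * g k ≤ n k) (hn : ∀ k, k + 1 ≤ n k) (hs : ∀ k, 0 < s k)
    (hclose : ∀ t > 0, ∃ᶠ k in atTop, ∀ j < s k, ∀ i < n k,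
      dist (f^[stageStart (n + g) s k + j * (n k + g k) + g k + i] x)
        (f^[stageStart (n + g) s k + j * (n k + g k) + g k + i] x') < t)
    {t₀ : ℝ} (ht₀ : 0 < t₀) {N : ℕ} (hfar : ∃ᶠ k in atTop, ∀ j < s k, ∀ i, N ≤ i → i < n k →
      t₀ ≤ dist (f^[stageStart (n + g) s k + j * (n k + g k) + g k + i] x)
        (f^[stageStart (n + g) s k + j * (n k + g k) + g k + i] x')) :
    IsDC1Pair f x x' := by
  set T := stageStart (n + g) s with hTdef
  have hTs : ∀ k, T (k + 1) = T k + s k * (n k + g k) := stageStart_succ (n + g) s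
  have hmono : StrictMono T := strictMono_stageStart (fun k => by
    have := hn k
    simp only [Pi.add_apply]
    omega) hs
  have hTpos : ∀ k, (0 : ℝ) < T (k + 1) := fun k => by
    exact_mod_cast (Nat.zero_le (T k)).trans_lt (hmono (Nat.lt_succ_self k))
  have hTtop : Tendsto (fun k => T (k + 1)) atTop atTop :=
    hmono.tendsto_atTop.comp (tendsto_add_atTop_nat 1)
  have hratio : ∀ i₀ : ℕ, ∀ η > 0, ∀ᶠ k in atTop,
      ((T k + s k * (g k + i₀) : ℕ) : ℝ) ≤ η * T (k + 1) := by
    intro i₀ η hη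
    have hlim : Tendsto (fun k : ℕ => (2 + i₀ : ℝ) * (1 / ((k : ℝ) + 1))) atTop
        (𝓝 ((2 + i₀ : ℝ) * 0)) := tendsto_one_div_add_atTop_nhds_zero_nat.const_mul _
    rw [mul_zero] at hlim
    filter_upwards [hlim.eventually (Iio_mem_nhds hη)] with k hk
    -- In `2 + i₀`, the past and the gaps count one each, and the initial times of the segments
    -- count `i₀`.
    have hnat : (k + 1) * (T k + s k * (g k + i₀)) ≤ (2 + i₀) * T (k + 1) := by
      have h1 : (k + 1) * (s k * (g k + i₀)) ≤ s k * (n k + n k * i₀) := by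
        calc (k + 1) * (s k * (g k + i₀)) = s k * ((k + 1) * g k + (k + 1) * i₀) := by ring
          _ ≤ s k * (n k + n k * i₀) := by
            have := hg k
            have := hn k
            gcongr
      have h2 : s k * (n k + n k * i₀) ≤ (1 + i₀) * (s k * (n k + g k)) := by
        calc s k * (n k + n k * i₀) = (1 + i₀) * (s k * n k) := by ring
          _ ≤ _ := by
            gcongr
            omega
      have h3 : s k * (n k + g k) ≤ T (k + 1) := by rw [hTs]; omega
      calc (k + 1) * (T k + s k * (g k + i₀)) = (k + 1) * T k + (k + 1) * (s k * (g k + i₀)) := by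
            ring
        _ ≤ s k * (n k + g k) + (1 + i₀) * (s k * (n k + g k)) :=
            add_le_add (hT k) (h1.trans h2)
        _ = (2 + i₀) * (s k * (n k + g k)) := by ring
        _ ≤ _ := by gcongr
    have hreal : ((k : ℝ) + 1) * (T k + s k * (g k + i₀) : ℕ) ≤ (2 + i₀) * T (k + 1) := by
      exact_mod_cast hnat
    have hk1 : (0 : ℝ) < (k : ℝ) + 1 := by positivity
    have hk' : (2 + i₀ : ℝ) * (1 / ((k : ℝ) + 1)) < η := hk
    rw [mul_one_div, div_lt_iff₀ hk1] at hk'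
    have h4 : ((k : ℝ) + 1) * (T k + s k * (g k + i₀) : ℕ) ≤ ((k : ℝ) + 1) * (η * T (k + 1)) := by
      calc _ ≤ _ := hreal
        _ ≤ (η * (k + 1)) * T (k + 1) := by
          have := (hTpos k).le
          gcongr
        _ = _ := by ring
    exact le_of_mul_le_mul_left h4 hk1
  constructor
  · intro t ht
    refine limsup_eq_one_of_frequently (closeFrequency_nonneg f x x' t)
      (closeFrequency_le_one f x x' t) fun η hη => ?_
    refine hTtop.frequently ?_
    refine ((hclose t ht).and_eventually (hratio 0 η hη)).mono fun k hk => ?_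
    obtain ⟨hk₁, hk₂⟩ := hk
    have hcard := card_filter_block_le (fun i => ¬ dist (f^[i] x) (f^[i] x') < t) (T k) (g k)
      (n k) 0 (s k) fun j hj i _ hi => not_not.2 (hk₁ j hj i hi)
    rw [← hTs] at hcard
    have hsum := Finset.card_filter_add_card_filter_not (s := Finset.range (T (k + 1)))
      (fun i => dist (f^[i] x) (f^[i] x') < t)
    rw [Finset.card_range] at hsum
    unfold closeFrequency
    rw [le_div_iff₀ (hTpos k)]
    have h1 : (T (k + 1) : ℝ) ≤
        ((Finset.range (T (k + 1))).filter fun i => dist (f^[i] x) (f^[i] x') < t).card +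
          (T k + s k * (g k + 0) : ℕ) := by
      exact_mod_cast (by omega)
    linarith
  · refine ⟨t₀, ht₀, liminf_eq_zero_of_frequently (closeFrequency_nonneg f x x' t₀)
      (closeFrequency_le_one f x x' t₀) fun η hη => ?_⟩
    refine hTtop.frequently ?_
    refine (hfar.and_eventually (hratio N η hη)).mono fun k hk => ?_
    obtain ⟨hk₁, hk₂⟩ := hk
    have hcard := card_filter_block_le (fun i => dist (f^[i] x) (f^[i] x') < t₀) (T k) (g k)
      (n k) N (s k) fun j hj i hi hi' => not_lt.2 (hk₁ j hj i hi hi')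
    rw [← hTs] at hcard
    unfold closeFrequency
    rw [div_le_iff₀ (hTpos k)]
    exact (Nat.cast_le.2 hcard).trans hk₂

/-- Time averages along an orbit tracing, with errors tending to zero, blocks of segments whose
averages are close to `c k` in the `k`-th stage. -/
theorem eventually_abs_average_le [CompactSpace X] {f : X → X} {x : X} {n g s J : ℕ → ℕ}
    {y : ℕ → ℕ → X} {ε : ℕ → ℝ} (hε : Tendsto ε atTop (𝓝 0))
    (htrace : ∀ k, ∀ j < s k, ∀ i ≤ n k,
      dist (f^[stageStart (n + g) s k + j * (n k + g k) + g k + i] x) (f^[i] (y k j)) ≤ ε k)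
    (hT : ∀ k, (k + 1) * stageStart (n + g) s k ≤ s k * (n k + g k))
    (hJT : ∀ k, (k + 1) * (J (k + 1) * (n (k + 1) + g (k + 1))) ≤ stageStart (n + g) s (k + 1))
    (hJ : ∀ k, 0 < J k) (hJs : ∀ k, J k ≤ s k)
    (hg : ∀ k, (k + 1) * g k ≤ n k) (hn : ∀ k, k + 1 ≤ n k) (φ : C(X, ℝ)) {c : ℕ → ℝ}
    (hc : ∀ k, |c k| ≤ ‖φ‖) (hc' : Tendsto (fun k => |c k - c (k + 1)|) atTop (𝓝 0))
    (havg : ∀ᶠ k in atTop, ∀ j, J k ≤ j →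
      |∑ t ∈ Finset.range j, ∑ i ∈ Finset.range (n k), φ (f^[i] (y k t)) - j * (n k * c k)| ≤
        j * ((n k : ℝ) / (k + 1))) {η : ℝ} (hη : 0 < η) :
    ∀ᶠ k in atTop, ∀ m, stageStart (n + g) s k ≤ m → m ≤ stageStart (n + g) s (k + 1) →
      |∑ i ∈ Finset.range m, (φ (f^[i] x) - c k)| ≤ η * m := by
  have hM : ∀ (z : X) k, |φ z - c k| ≤ 2 * ‖φ‖ := fun z k => by
    refine (abs_sub _ _).trans ?_
    have h1 : |φ z| ≤ ‖φ‖ := φ.norm_coe_le_norm z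
    linarith [hc k]
  refine abs_average_sub_le (ψ := fun i => φ (f^[i] x)) (fun i k => hM _ k) hc' (fun k => ?_)
    hJ hJT hT hJs ?_ hη
  · have := hn k
    simp only [Pi.add_apply]
    omega
  intro η hη
  have huc := CompactSpace.uniformContinuous_of_continuous φ.continuous
  rw [Metric.uniformContinuous_iff] at huc
  obtain ⟨δ, hδ, huc⟩ := huc (η / 2) (by positivity)
  have hlim : Tendsto (fun k : ℕ => (2 * ‖φ‖ + 1) * (1 / ((k : ℝ) + 1))) atTop
      (𝓝 ((2 * ‖φ‖ + 1) * 0)) := tendsto_one_div_add_atTop_nhds_zero_nat.const_mul _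
  rw [mul_zero] at hlim
  filter_upwards [havg, hε.eventually (Iio_mem_nhds hδ),
    hlim.eventually (Iio_mem_nhds (show 0 < η / 2 by positivity))] with k hk₁ hk₂ hk₃ j hJj hjs
  have hblocks := abs_sum_blocks_sub_le (ψ := fun i => φ (f^[i] x) - c k)
    (ρ := fun t i => φ (f^[i] (y k t)) - c k) (fun i => hM _ k) (stageStart (n + g) s k) (g k)
    (n k) j (η := η / 2) fun t ht i hi => by
      rw [sub_sub_sub_cancel_right]
      exact (huc ((htrace k t (ht.trans_le hjs) i hi.le).trans_lt hk₂)).le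
  have hρ : ∑ t ∈ Finset.range j, ∑ i ∈ Finset.range (n k), (φ (f^[i] (y k t)) - c k) =
      ∑ t ∈ Finset.range j, ∑ i ∈ Finset.range (n k), φ (f^[i] (y k t)) - j * (n k * c k) := by
    simp [Finset.sum_sub_distrib]
  rw [hρ] at hblocks
  have h1 := hk₁ j hJj
  have hk1 : (0 : ℝ) < (k : ℝ) + 1 := by positivity
  have hgn : (g k : ℝ) ≤ n k / (k + 1) := by
    rw [le_div_iff₀ hk1, mul_comm]
    exact_mod_cast hg k
  -- Gaps and sampling error are each of order `n k / (k + 1)` per block; together they use half of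
  -- `η`, and tracing uses the other half.
  have h2 : (g k : ℝ) * (2 * ‖φ‖) ≤ n k / (k + 1) * (2 * ‖φ‖) := by gcongr
  have h3 : (n k : ℝ) / (k + 1) * (2 * ‖φ‖) + n k / (k + 1) ≤ n k * (η / 2) := by
    calc (n k : ℝ) / (k + 1) * (2 * ‖φ‖) + n k / (k + 1) =
        n k * ((2 * ‖φ‖ + 1) * (1 / ((k : ℝ) + 1))) := by ring
      _ ≤ n k * (η / 2) := by
        have : (2 * ‖φ‖ + 1) * (1 / ((k : ℝ) + 1)) ≤ η / 2 := le_of_lt hk₃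
        gcongr
  have h4 : (j : ℝ) * (g k * (2 * ‖φ‖) + n k * (η / 2)) + j * ((n k : ℝ) / (k + 1)) ≤
      η * (j * (n + g) k : ℕ) := by
    calc (j : ℝ) * (g k * (2 * ‖φ‖) + n k * (η / 2)) + j * ((n k : ℝ) / (k + 1)) =
        j * (g k * (2 * ‖φ‖) + n k / (k + 1) + n k * (η / 2)) := by ring
      _ ≤ j * (n k * (η / 2) + n k * (η / 2)) := by
        gcongr
        linarith
      _ = η * (j * n k) := by ring
      _ ≤ η * (j * (n + g) k : ℕ) := by
        simp only [Pi.add_apply]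
        push_cast
        gcongr
        simp
  rw [abs_le] at hblocks h1 ⊢
  simp only [Pi.add_apply] at h4 ⊢
  constructor <;> linarith [hblocks.1, hblocks.2, h1.1, h1.2]

end Tracing

end DistChaos

/-! ### Construction of the scrambled set -/

open DistChaos Topology in
theorem theoremE {X : Type*} [MetricSpace X] [CompactSpace X] [MeasurableSpace X] [BorelSpace X]
    (f : X → X) (hf : Continuous f) (hspec : DistChaos.Specification f)
    (K : Set (ProbabilityMeasure X)) (hKinv : K ⊆ DistChaos.invariantMeasures f)
    (hKcompact : IsCompact K) (hKconn : IsConnected K)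
    (μ μ₁ μ₂ : ProbabilityMeasure X) (hμ : μ ∈ K)
    (hμ₁ : μ₁ ∈ DistChaos.invariantMeasures f) (hμ₂ : μ₂ ∈ DistChaos.invariantMeasures f)
    (θ : ℝ) (hθ : θ ∈ Set.Icc (0 : ℝ) 1)
    (hcomb : (μ : Measure X) =
      ENNReal.ofReal θ • (μ₁ : Measure X) + ENNReal.ofReal (1 - θ) • (μ₂ : Measure X))
    (hdistal₁ : DistChaos.HasDistalPair f (DistChaos.genericPoints f μ₁))
    (hdistal₂ : DistChaos.HasDistalPair f (DistChaos.genericPoints f μ₂))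
    (U : Set X) (hU : IsOpen U) (hUne : U.Nonempty) :
    ∃ S : Set X,
      S ⊆ DistChaos.saturatedSet f K ∩ U ∩ DistChaos.transitivePoints f ∧
        ¬ S.Countable ∧ DistChaos.IsDC1Scrambled f S := by
  obtain ⟨α, hαK, hαint, hαcl, hαfr⟩ := exists_measure_sequence hKcompact hKconn hμ
  obtain ⟨c, hc⟩ := exists_labelling hαfr
  obtain ⟨p₁, hp₁, t₁, ht₁, N₁, hfar₁⟩ := hdistal₁.exists_bool_family
  obtain ⟨p₂, hp₂, t₂, ht₂, N₂, hfar₂⟩ := hdistal₂.exists_bool_family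
  obtain ⟨u, hu⟩ := hUne
  have : Nonempty X := ⟨u⟩
  obtain ⟨r, hr, hrU⟩ := Metric.isOpen_iff.1 hU u hu
  -- With `r / 3` the glued point lies within `2 * r / 3` of `u`, hence in `U`.
  obtain ⟨g, -, hglue⟩ := hspec.exists_glue hf (show 0 < r / 3 by positivity)
  let φ : ℕ → C(X, ℝ) := TopologicalSpace.denseSeq C(X, ℝ)
  let d : ℕ → X := fun k => TopologicalSpace.denseSeq X (Nat.unpair (k / 2)).1
  have hstage : ∀ k, ∃ (n J : ℕ) (y : Bool → ℕ → X), 0 < J ∧ (k + 1) * g k ≤ n ∧ k + 1 ≤ n ∧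
      (∀ j, J ≤ j → ∀ b, ∀ m ≤ k,
        |∑ t ∈ Finset.range j, ∑ i ∈ Finset.range n, φ m (f^[i] (y b t)) -
          j * (n * ∫ z, φ m z ∂(α k : Measure X))| ≤ j * ((n : ℝ) / (k + 1))) ∧
      (Even k → (∀ b, y b = y true) ∧ ∀ b, y b 0 = d k) ∧
      (Odd k → α k = μ → ∀ t, (∀ b, y b t = p₁ b) ∨ ∀ b, y b t = p₂ b) := by
    intro k
    by_cases hk : Odd k ∧ α k = μ
    · obtain ⟨n, J, y, hJ, hg, hn, hy, havg⟩ :=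
        exists_distal_stage hf hθ hcomb hp₁ hp₂ φ k (g k)
      refine ⟨n, J, y, hJ, hg, hn, ?_, fun he => ?_, fun _ _ => hy⟩
      · rwa [hk.2]
      · exact absurd hk.1 (Nat.not_odd_iff_even.2 he)
    · obtain ⟨n, J, y, hJ, hg, hn, hy, havg⟩ :=
        exists_common_stage hf (hKinv (hαK k)) φ k (g k) (d k)
      exact ⟨n, J, fun _ => y, hJ, hg, hn, fun j hj _ => havg j hj,
        fun _ => ⟨fun _ => rfl, fun _ => hy⟩, fun h₁ h₂ => absurd ⟨h₁, h₂⟩ hk⟩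
  choose n J y hJ hg hn havg hcommon hdist using hstage
  obtain ⟨s, hJs, hT, hJT⟩ := exists_stage_sizes (n + g) J fun k => by
    have := hn k
    simp only [Pi.add_apply]
    omega
  have hspos : ∀ k, 0 < s k := fun k => (hJ k).trans_le (hJs k)
  have hTmono : StrictMono (stageStart (n + g) s) := strictMono_stageStart (fun k => by
    have := hn k
    simp only [Pi.add_apply]
    omega) hspos
  choose x hxu hx using fun ξ : ℕ → Bool => hglue n s hspos u fun k => y k (ξ (c k))
  set ε : ℕ → ℝ := fun k => 2 * (r / 3) / 2 ^ k with hεdef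
  have hε : Tendsto ε atTop (𝓝 0) := by
    have h := (tendsto_pow_atTop_nhds_zero_of_lt_one (r := (1 / 2 : ℝ)) (by norm_num)
      (by norm_num)).const_mul (2 * (r / 3))
    rw [mul_zero] at h
    refine h.congr fun k => ?_
    simp only [hεdef, div_pow, one_pow, mul_one_div]
  have hDC1 : ∀ ξ ξ', ξ ≠ ξ' → IsDC1Pair f (x ξ) (x ξ') := by
    intro ξ ξ' hne
    obtain ⟨m, hm⟩ := Function.ne_iff.1 hne
    have hε3 : ∀ t > 0, ∀ᶠ k in atTop, ε k < t := fun t ht => hε.eventually (Iio_mem_nhds ht)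
    refine isDC1Pair_of_stages hT hg hn hspos (fun t ht => ?_)
      -- Two tracing errors below a quarter of the separation leave at least half of it.
      (t₀ := min t₁ t₂ / 2) (by positivity) (N := max N₁ N₂) ?_
    · have heven : ∃ᶠ k : ℕ in atTop, Even k :=
        frequently_atTop.2 fun a => ⟨2 * a, by omega, even_two_mul a⟩
      refine (heven.and_eventually (hε3 (t / 2) (by positivity))).mono fun k hk j hj i hi => ?_
      have h1 := hx ξ k j hj i hi.le
      have h2 := hx ξ' k j hj i hi.le
      simp only [(hcommon k hk.1).1 (ξ (c k))] at h1
      simp only [(hcommon k hk.1).1 (ξ' (c k))] at h2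
      have h3 := dist_triangle_right
        (f^[stageStart (n + g) s k + j * (n k + g k) + g k + i] (x ξ))
        (f^[stageStart (n + g) s k + j * (n k + g k) + g k + i] (x ξ')) (f^[i] (y k true j))
      have h4 : ε k < t / 2 := hk.2
      simp only [hεdef] at h4
      linarith
    · refine ((hc m).and_eventually (hε3 (min t₁ t₂ / 4) (by positivity))).mono
        fun k hk j hj i hNi hi => ?_
      obtain ⟨⟨⟨hodd, hαμ⟩, hcm⟩, hεk⟩ := hk
      have h1 := hx ξ k j hj i hi.le
      have h2 := hx ξ' k j hj i hi.le
      simp only [hεdef] at hεk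
      rw [hcm] at h1 h2
      have hsep : min t₁ t₂ ≤ dist (f^[i] (y k (ξ m) j)) (f^[i] (y k (ξ' m) j)) := by
        rcases hdist k hodd hαμ j with h | h
        · rw [h, h]
          exact (min_le_left _ _).trans
            (hfar₁ _ _ hm i ((le_max_left _ _).trans hNi))
        · rw [h, h]
          exact (min_le_right _ _).trans
            (hfar₂ _ _ hm i ((le_max_right _ _).trans hNi))
      have h3 := dist_triangle4_left
        (f^[stageStart (n + g) s k + j * (n k + g k) + g k + i] (x ξ))
        (f^[stageStart (n + g) s k + j * (n k + g k) + g k + i] (x ξ'))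
        (f^[i] (y k (ξ m) j)) (f^[i] (y k (ξ' m) j))
      linarith
  have hinj : Function.Injective x := by
    intro ξ ξ' h
    by_contra hne
    have h1 := hDC1 ξ ξ' hne
    rw [h] at h1
    exact not_isDC1Pair_self f _ h1
  refine ⟨Set.range x, ?_, ?_, ?_⟩
  · rintro _ ⟨ξ, rfl⟩
    refine ⟨⟨?_, ?_⟩, ?_⟩
    · refine mem_saturatedSet_of_averages hKcompact.isClosed
        (TopologicalSpace.denseRange_denseSeq C(X, ℝ)) hαK hαcl
        (T := stageStart (n + g) s) rfl hTmono fun m η hη => ?_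
      refine eventually_abs_average_le hε (hx ξ) hT hJT hJ hJs hg hn _ (fun k => ?_)
        (hαint _) ?_ hη
      · simpa using norm_integral_le_of_norm_le_const (μ := (α k : Measure X))
          (Eventually.of_forall fun z => (φ m).norm_coe_le_norm z)
      · filter_upwards [eventually_ge_atTop m] with k hk j hj
        exact havg k j hj _ m hk
    · refine hrU (Metric.mem_ball.2 ((hxu ξ).trans_lt ?_))
      linarith
    · refine Set.eq_univ_of_forall fun w => ?_
      rw [mem_omegaLimit_singleton_iff_mapClusterPt, mapClusterPt_iff_frequently]
      intro V hV
      obtain ⟨ρ, hρ, hρV⟩ := Metric.mem_nhds_iff.1 hV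
      obtain ⟨m, hm⟩ := (TopologicalSpace.denseRange_denseSeq X).exists_dist_lt w
        (show 0 < ρ / 2 by positivity)
      obtain ⟨N, hN⟩ := eventually_atTop.1
        (hε.eventually (Iio_mem_nhds (show 0 < ρ / 2 by positivity)))
      rw [frequently_atTop]
      intro a
      have hk₀ := Nat.right_le_pair m (max N a)
      have hN' := le_max_left N a
      have ha := le_max_right N a
      -- An even stage whose first segment starts at the `m`-th dense point, late enough for both
      -- the tracing error and the required time.
      set k := 2 * Nat.pair m (max N a) with hk
      have hdk : d k = TopologicalSpace.denseSeq X m := by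
        simp only [d, hk, Nat.mul_div_cancel_left _ two_pos, Nat.unpair_pair]
      have h1 := hx ξ k 0 (hspos k) 0 (Nat.zero_le _)
      rw [(hcommon k (even_two_mul _)).2, hdk] at h1
      refine ⟨_, ?_, hρV (Metric.mem_ball.2 ((dist_triangle _ _ _).trans_lt
        (add_lt_add_of_le_of_lt h1 ((dist_comm _ _).trans_lt hm) |>.trans ?_)))⟩
      · have := hTmono.id_le k
        simp only [id] at this
        omega
      · have h2 : ε k < ρ / 2 := hN k (by omega)
        simp only [hεdef] at h2
        linarith
  · intro hcount
    have h := hcount.preimage hinj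
    rw [Set.preimage_range, Set.countable_univ_iff] at h
    obtain ⟨e, he⟩ := exists_surjective_nat (ℕ → Bool)
    obtain ⟨k, hk⟩ := he fun i => !(e i i)
    simpa using congrFun hk k
  · rintro _ ⟨ξ, rfl⟩ _ ⟨ξ', rfl⟩ hne
    exact hDC1 ξ ξ' fun h => hne (by rw [h])
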